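/- Let the scalar field $\mathbb{K}$ be $\mathbb{R}$ or $\mathbb{C}$, and for a compact Hausdorff space $K$ let $C(K)$ be the Banach space of continuous functions $K\to\mathbb{K}$ with the supremum norm. For distinct $f,g\in C(K)$ write $f\prec g$ if $f$ and $g$ agree on $\operatorname{supp} f=\overline{\{t\in K: f(t)\neq 0\}}$. A bounded linear operator $T\colon C(K)\to X$ into a Banach space $X$ has the Bishop property if $\inf\{\|Tf-Tg\| : f,g\in F,\ f\prec g\}=0$ for every norm-bounded uncountable $\prec$-chain $F\subseteq C(K)$ (that is, a set any two distinct elements of which are comparable under $\prec$). The space $K$ has the Bishop property if the identity operator on $C(K)$ has it. Let $\beta\mathbb{N}$ be the Čech–Stone compactification of the discrete space $\mathbb{N}$, and let $B$ be the closed unit ball of the dual space $C(\beta\mathbb{N})^*$, endowed with the weak* topology (a compact Hausdorff space). Then: (i) $B$ has the Bishop property; (ii) there is a linear homeomorphism of $C(B)$ onto $C(B\sqcup\beta\mathbb{N})$, where $\sqcup$ denotes topological disjoint union; (iii) $B\sqcup\beta\mathbb{N}$ does not have the Bishop property. In particular, the Bishop property is not invariant under Banach-space isomorphisms of $C(K)$-spaces: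 it is not true that, whenever $K$ and $L$ are compact Hausdorff spaces such that $C(K)$ and $C(L)$ are linearly homeomorphic and $K$ has the Bishop property, $L$ also has the Bishop property. -/

import Mathlib

namespace BishopProperty

/-- `f ≺ g`: `f` and `g` are distinct and `g` agrees with `f` on the (closed) support of `f`. -/
def Prec {K 𝕜 : Type*} [TopologicalSpace K] [RCLike 𝕜] (f g : C(K, 𝕜)) : Prop :=
  f ≠ g ∧ Set.EqOn f g (tsupport f)

/-- A bounded operator `T : C(K) → X` has the Bishop property if
`inf {‖T f - T g‖ : f, g ∈ F, f ≺ g} = 0` for every norm-bounded uncountable `≺`-chain `F`. -/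
def OperatorBishop {K 𝕜 X : Type*} [TopologicalSpace K] [CompactSpace K] [RCLike 𝕜]
    [NormedAddCommGroup X] [NormedSpace 𝕜 X] [CompleteSpace X] (T : C(K, 𝕜) →L[𝕜] X) : Prop :=
  ∀ F : Set C(K, 𝕜), Bornology.IsBounded F → ¬ F.Countable → IsChain Prec F →
    IsGLB {r : ℝ | ∃ f ∈ F, ∃ g ∈ F, Prec f g ∧ r = ‖T f - T g‖} 0

/-- A compact space `K` has the Bishop property if the identity operator on `C(K)` has it. -/
def SpaceBishop (𝕜 K : Type*) [RCLike 𝕜] [TopologicalSpace K] [CompactSpace K] : Prop :=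
  OperatorBishop (ContinuousLinearMap.id 𝕜 C(K, 𝕜))

/-- The closed unit ball of the dual of `C(βℕ)`, with the weak* topology. -/
abbrev DualBall (𝕜 : Type*) [RCLike 𝕜] : Type _ :=
  {φ : WeakDual 𝕜 C(StoneCech ℕ, 𝕜) // ‖WeakDual.toStrongDual φ‖ ≤ 1}

/-- The dual unit ball is weak* compact (Banach-Alaoglu). -/
instance instCompactSpaceDualBall (𝕜 : Type*) [RCLike 𝕜] : CompactSpace (DualBall 𝕜) := by
  have h := WeakDual.isCompact_closedBall (0 : StrongDual 𝕜 C(StoneCech ℕ, 𝕜)) 1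
  have h' : WeakDual.toStrongDual ⁻¹' Metric.closedBall (0 : StrongDual 𝕜 C(StoneCech ℕ, 𝕜)) 1
      = {φ : WeakDual 𝕜 C(StoneCech ℕ, 𝕜) | ‖WeakDual.toStrongDual φ‖ ≤ 1} := by
    ext φ
    exact mem_closedBall_zero_iff
  rw [h'] at h
  exact isCompact_iff_compactSpace.mp h

end BishopProperty

namespace BishopProperty

open Topology Set

section LocallyConnected

variable {K 𝕜 : Type*} [TopologicalSpace K] [RCLike 𝕜]

/-! If `f ≺ g`, then `{f ≠ 0}` is clopen in `{g ≠ 0}`, so its components are components of `{g ≠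
0}`; if also `δ ≤ ‖f - g‖`, then `{g ≠ 0}` has a further component on which `‖g‖` reaches `δ`. On a
locally connected compact space such components are finite in number, so counting them injects a
`δ`-separated chain into `ℕ`. The dual ball, convex in a locally convex space, is locally connected.
In contrast, `βℕ` carries a chain of clopen sets indexed by `ℝ`, whose indicators are at mutual
distance at least 1. The isomorphism is a decomposition argument: `C(βℕ)` is complemented in `C(B)`
and isomorphic to its own square. -/

/-- The components of `{f ≠ 0}` which meet `{δ ≤ ‖f‖}`. -/
def largeComponents (f : C(K, 𝕜)) (δ : ℝ) : Set (Set K) :=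
  connectedComponentIn (Function.support f) '' {t | δ ≤ ‖f t‖}

theorem mem_support_of_le_norm {f : C(K, 𝕜)} {δ : ℝ} (hδ : 0 < δ) {t : K} (ht : δ ≤ ‖f t‖) :
    t ∈ Function.support f := by
  rw [Function.mem_support, ← norm_pos_iff]
  exact hδ.trans_le ht

/-- By local connectedness the components of an open set are open, so finitely many cover the
compact set `{δ ≤ ‖f‖}`. -/
theorem finite_largeComponents [CompactSpace K] [LocallyConnectedSpace K] (f : C(K, 𝕜)) {δ : ℝ}
    (hδ : 0 < δ) : (largeComponents f δ).Finite := by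
  have hU : IsOpen (Function.support f) := f.continuous.isOpen_support
  have hC : IsCompact {t | δ ≤ ‖f t‖} :=
    (isClosed_le continuous_const f.continuous.norm).isCompact
  obtain ⟨s, hs, hcover⟩ := hC.elim_nhds_subcover
    (fun t => connectedComponentIn (Function.support f) t) fun t ht =>
      hU.connectedComponentIn.mem_nhds (mem_connectedComponentIn (mem_support_of_le_norm hδ ht))
  refine (s.finite_toSet.image (connectedComponentIn (Function.support f))).subset ?_
  rintro _ ⟨t, ht, rfl⟩
  obtain ⟨u, hu, htu⟩ := mem_iUnion₂.mp (hcover ht)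
  exact ⟨u, hu, connectedComponentIn_eq htu⟩

theorem Prec.support_subset {f g : C(K, 𝕜)} (h : Prec f g) :
    Function.support f ⊆ Function.support g := fun t ht => by
  rw [Function.mem_support, ← h.2 (subset_tsupport f ht)]
  exact ht

theorem Prec.support_eq_inter {f g : C(K, 𝕜)} (h : Prec f g) :
    Function.support f = tsupport f ∩ Function.support g := by
  refine subset_antisymm (subset_inter (subset_tsupport f) h.support_subset) ?_
  rintro t ⟨ht, htg⟩
  rw [Function.mem_support, h.2 ht]
  exact htg

/-- A component of `{g ≠ 0}` meeting the relatively clopen set `{f ≠ 0}` cannot leave it. -/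
theorem Prec.connectedComponentIn_eq {f g : C(K, 𝕜)} (h : Prec f g) {t : K}
    (ht : t ∈ Function.support f) :
    connectedComponentIn (Function.support f) t = connectedComponentIn (Function.support g) t := by
  refine subset_antisymm (connectedComponentIn_mono t h.support_subset) ?_
  refine isPreconnected_connectedComponentIn.subset_connectedComponentIn
    (mem_connectedComponentIn (h.support_subset ht)) ?_
  have hsub := connectedComponentIn_subset (Function.support g) t
  refine isPreconnected_connectedComponentIn.subset_left_of_subset_union
    f.continuous.isOpen_support (isClosed_tsupport f).isOpen_compl
    (disjoint_compl_right.mono_left (subset_tsupport f)) ?_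
    ⟨t, mem_connectedComponentIn (h.support_subset ht), ht⟩
  intro u hu
  by_cases hf : u ∈ tsupport f
  · exact Or.inl (h.support_eq_inter ▸ ⟨hf, hsub hu⟩)
  · exact Or.inr hf

theorem Prec.largeComponents_ssubset [CompactSpace K] {f g : C(K, 𝕜)} (h : Prec f g) {δ : ℝ}
    (hδ : 0 < δ) (hfg : δ ≤ ‖f - g‖) : largeComponents f δ ⊂ largeComponents g δ := by
  have hsub : largeComponents f δ ⊆ largeComponents g δ := by
    rintro _ ⟨t, ht, rfl⟩
    have hts := mem_support_of_le_norm hδ ht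
    refine ⟨t, ?_, (h.connectedComponentIn_eq hts).symm⟩
    exact ht.trans_eq (congrArg norm (h.2 (subset_tsupport f hts)))
  obtain ⟨t, ht⟩ : ∃ t, δ ≤ ‖(f - g) t‖ := by
    by_contra! hlt
    exact hfg.not_gt ((ContinuousMap.norm_lt_iff _ hδ).mpr hlt)
  -- `f` and `g` agree wherever `f ≠ 0`, so they can only differ at a zero of `f`. The component of
  -- `{g ≠ 0}` at `t` is therefore new.
  have hft : f t = 0 := by
    by_contra hne
    rw [ContinuousMap.sub_apply, h.2 (subset_tsupport f hne), sub_self, norm_zero] at ht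
    exact ht.not_gt hδ
  rw [ContinuousMap.sub_apply, hft, zero_sub, norm_neg] at ht
  refine (ssubset_iff_of_subset hsub).mpr ⟨_, mem_image_of_mem _ ht, ?_⟩
  rintro ⟨u, hu, hut⟩
  have htu := mem_connectedComponentIn (mem_support_of_le_norm hδ ht)
  rw [← hut] at htu
  exact connectedComponentIn_subset _ _ htu hft

theorem spaceBishop_of_locallyConnectedSpace [CompactSpace K] [LocallyConnectedSpace K] :
    SpaceBishop 𝕜 K := by
  intro F _ hF hchain
  refine ⟨?_, fun δ hδ => ?_⟩
  · rintro _ ⟨f, _, g, _, _, rfl⟩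
    exact norm_nonneg _
  by_contra! hpos
  have key : ∀ f ∈ F, ∀ g ∈ F, Prec f g →
      (largeComponents f δ).ncard < (largeComponents g δ).ncard := fun f hf g hg hfg =>
    ncard_lt_ncard (hfg.largeComponents_ssubset hpos (hδ ⟨f, hf, g, hg, hfg, rfl⟩))
      (finite_largeComponents g hpos)
  refine hF (MapsTo.countable_of_injOn (f := fun f => (largeComponents f δ).ncard)
    (mapsTo_univ _ _) ?_ (countable_univ))
  intro f hf g hg hfg
  by_contra hne
  rcases hchain hf hg hne with h | h
  · exact (key f hf g hg h).ne hfg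
  · exact (key g hg f hf h).ne' hfg

end LocallyConnected

section DualBall

variable (𝕜 : Type*) [RCLike 𝕜]

/-- Convex neighbourhoods meet a convex range in convex, hence connected, sets. Using an inducing
map lets the weak* topology be handled by evaluation into a product of copies of `𝕜`. -/
theorem locallyConnectedSpace_of_convex_range {X E : Type*} [TopologicalSpace X] [AddCommGroup E]
    [Module ℝ E] [TopologicalSpace E] [IsTopologicalAddGroup E] [ContinuousSMul ℝ E]
    [LocallyConvexSpace ℝ E] {f : X → E} (hf : IsInducing f) (hs : Convex ℝ (range f)) :
    LocallyConnectedSpace X := by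
  refine locallyConnectedSpace_of_connected_bases
    (fun (_ : X) (t : Set E) => f ⁻¹' t)
    (fun x t => t ∈ 𝓝 (f x) ∧ Convex ℝ t) (fun x => ?_) ?_
  · rw [hf.nhds_eq_comap]
    exact (LocallyConvexSpace.convex_basis (𝕜 := ℝ) (f x)).comap _
  · rintro x t ⟨-, ht⟩
    rw [← hf.isPreconnected_image, image_preimage_eq_inter_range]
    exact (ht.inter hs).isPreconnected

theorem convex_range_dualBall_apply :
    Convex ℝ (range fun (φ : DualBall 𝕜) (x : C(StoneCech ℕ, 𝕜)) => φ.1 x) := by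
  rintro _ ⟨φ, rfl⟩ _ ⟨ψ, rfl⟩ a b ha hb hab
  refine ⟨⟨(a : 𝕜) • φ.1 + (b : 𝕜) • ψ.1, ?_⟩, ?_⟩
  · rw [map_add, map_smul, map_smul]
    refine (norm_add_le _ _).trans ?_
    rw [norm_smul, norm_smul, RCLike.norm_of_nonneg ha, RCLike.norm_of_nonneg hb]
    exact (add_le_add (mul_le_of_le_one_right ha φ.2) (mul_le_of_le_one_right hb ψ.2)).trans_eq hab
  · ext x
    rw [Pi.add_apply, Pi.smul_apply, Pi.smul_apply, RCLike.real_smul_eq_coe_mul,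
      RCLike.real_smul_eq_coe_mul]
    rfl

instance instLocallyConnectedSpaceDualBall : LocallyConnectedSpace (DualBall 𝕜) :=
  locallyConnectedSpace_of_convex_range
    (IsInducing.comp (g := fun (φ : WeakDual 𝕜 C(StoneCech ℕ, 𝕜)) (x : C(StoneCech ℕ, 𝕜)) => φ x)
      ⟨rfl⟩ .subtypeVal)
    (convex_range_dualBall_apply 𝕜)

end DualBall

section ClopenChain

variable {K 𝕜 : Type*} [TopologicalSpace K] [CompactSpace K] [RCLike 𝕜]

theorem not_spaceBishop_of_strictMono_isClopen {U : ℝ → Set K} (hU : ∀ r, IsClopen (U r))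
    (hmono : StrictMono U) : ¬ SpaceBishop 𝕜 K := by
  classical
  let f : ℝ → C(K, 𝕜) := fun r => (LocallyConstant.charFn 𝕜 (hU r)).toContinuousMap
  have hf : ∀ r t, f r t = (U r).indicator 1 t := fun r t => rfl
  have hdist : ∀ r s, r ≠ s → 1 ≤ ‖f r - f s‖ := by
    have hlt : ∀ r s, r < s → 1 ≤ ‖f r - f s‖ := fun r s hrs => by
      obtain ⟨t, hts, htr⟩ := exists_of_ssubset (hmono hrs)
      have := (f r - f s).norm_coe_le_norm t
      simpa [hf, hts, htr] using this
    intro r s hrs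
    rcases hrs.lt_or_gt with h | h
    · exact hlt r s h
    · rw [norm_sub_rev]
      exact hlt s r h
  have hne : ∀ r s, r ≠ s → f r ≠ f s := fun r s hrs h => by
    have := hdist r s hrs
    rw [h, sub_self, norm_zero] at this
    exact absurd this (by norm_num)
  have hsupp : ∀ r, tsupport (f r) ⊆ U r := fun r =>
    closure_minimal (fun t ht => by
      by_contra htr
      exact ht (by simp [hf, htr])) (hU r).isClosed
  have hprec : ∀ r s, r < s → Prec (f r) (f s) := fun r s hrs =>
    ⟨hne r s hrs.ne, fun t ht => by
      have hr := hsupp r ht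
      simp [hf, hr, (hmono hrs).subset hr]⟩
  intro h
  have hbdd : Bornology.IsBounded (range f) := by
    refine isBounded_iff_forall_norm_le.mpr ⟨1, ?_⟩
    rintro _ ⟨r, rfl⟩
    refine (ContinuousMap.norm_le _ zero_le_one).mpr fun t => ?_
    by_cases ht : t ∈ U r <;> simp [hf, ht]
  have hunc : ¬ (range f).Countable := by
    rw [← image_univ]
    intro hc
    have hinj : Function.Injective f := fun r s hrs => by
      by_contra hne'
      exact hne r s hne' hrs
    exact Cardinal.not_countable_real (countable_of_injective_of_countable_image hinj.injOn hc)
  have hchain : IsChain Prec (range f) := by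
    rintro _ ⟨r, rfl⟩ _ ⟨s, rfl⟩ hrs
    rcases lt_trichotomy r s with h | rfl | h
    · exact Or.inl (hprec r s h)
    · exact absurd rfl hrs
    · exact Or.inr (hprec s r h)
  refine absurd (a := (1 : ℝ) ≤ 0) ((h (range f) hbdd hunc hchain).2 ?_) (by norm_num)
  rintro _ ⟨_, ⟨r, rfl⟩, _, ⟨s, rfl⟩, hp, rfl⟩
  exact hdist r s fun hrs => hp.1 (by rw [hrs])

end ClopenChain

/-- Enumerate `ℚ` by `ℕ` and extend the indicators of the Dedekind cuts `{n | q n < r}` to `βℕ`. -/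
theorem exists_strictMono_isClopen_stoneCech_nat :
    ∃ U : ℝ → Set (StoneCech ℕ), (∀ r, IsClopen (U r)) ∧ StrictMono U := by
  classical
  obtain ⟨q, hq⟩ := exists_surjective_nat ℚ
  let e : ℝ → StoneCech ℕ → Bool := fun r =>
    stoneCechExtend (g := fun n => decide ((q n : ℝ) < r)) continuous_of_discreteTopology
  have hcont : ∀ r, Continuous (e r) := fun r => continuous_stoneCechExtend _
  have hunit : ∀ r n, e r (stoneCechUnit n) = decide ((q n : ℝ) < r) := fun r n =>
    stoneCechExtend_stoneCechUnit _ n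
  refine ⟨fun r => e r ⁻¹' {true}, fun r => (isClopen_discrete _).preimage (hcont r),
    fun r s hrs => ?_⟩
  -- Inclusion is written as an equation of continuous maps, so that it passes from the dense copy
  -- of `ℕ` to `βℕ`.
  have hle : (fun t => e r t && e s t) = e r := by
    refine stoneCech_hom_ext (by fun_prop) (hcont r) ?_
    ext n
    simp only [Function.comp_apply, hunit]
    by_cases h : (q n : ℝ) < r
    · simp [h, h.trans hrs]
    · simp [h]
  refine (ssubset_iff_of_subset fun t ht => ?_).mpr ?_
  · have := congrFun hle t
    simp only [mem_preimage, mem_singleton_iff] at ht ⊢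
    simpa [ht] using this
  · obtain ⟨x, hrx, hxs⟩ := exists_rat_btwn hrs
    obtain ⟨n, rfl⟩ := hq x
    exact ⟨stoneCechUnit n, by simp [hunit, hxs], by simp [hunit, hrx.le]⟩

theorem not_spaceBishop_sum_stoneCech_nat (𝕜 K : Type*) [RCLike 𝕜] [TopologicalSpace K]
    [CompactSpace K] : ¬ SpaceBishop 𝕜 (K ⊕ StoneCech ℕ) := by
  obtain ⟨U, hU, hmono⟩ := exists_strictMono_isClopen_stoneCech_nat
  refine not_spaceBishop_of_strictMono_isClopen (U := fun r => Sum.inr '' U r)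
    (fun r => ⟨IsClosedEmbedding.inr.isClosedMap _ (hU r).isClosed,
      IsOpenEmbedding.inr.isOpenMap _ (hU r).isOpen⟩)
    (Sum.inr_injective.image_strictMono.comp hmono)

section Isomorphism

variable {X Y Z 𝕜 : Type*} [TopologicalSpace X] [TopologicalSpace Y] [TopologicalSpace Z]
  [RCLike 𝕜]

/-- Functions on a disjoint union are pairs of functions on the pieces. -/
noncomputable def continuousMapSumEquiv [CompactSpace X] [CompactSpace Y] :
    C(X ⊕ Y, 𝕜) ≃L[𝕜] C(X, 𝕜) × C(Y, 𝕜) :=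
  ContinuousLinearEquiv.ofBijective
    ((ContinuousMap.compCLM 𝕜 𝕜 (⟨Sum.inl, continuous_inl⟩ : C(X, X ⊕ Y))).prod
      (ContinuousMap.compCLM 𝕜 𝕜 (⟨Sum.inr, continuous_inr⟩ : C(Y, X ⊕ Y))))
    (LinearMap.ker_eq_bot.mpr fun f g h => by
      ext (x | y)
      · exact DFunLike.congr_fun (congrArg Prod.fst h) x
      · exact DFunLike.congr_fun (congrArg Prod.snd h) y)
    (LinearMap.range_eq_top.mpr fun p =>
      ⟨⟨Sum.elim p.1 p.2, p.1.continuous.sumElim p.2.continuous⟩, rfl⟩)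

/-- `βℕ` is homeomorphic to two disjoint copies of itself. -/
noncomputable def stoneCechNatSumHomeomorph : StoneCech ℕ ≃ₜ StoneCech ℕ ⊕ StoneCech ℕ where
  toFun := stoneCechExtend (g := fun n => Sum.map stoneCechUnit stoneCechUnit
    (Equiv.natSumNatEquivNat.symm n)) continuous_of_discreteTopology
  invFun := Sum.elim
    (stoneCechExtend (g := fun n => stoneCechUnit (Equiv.natSumNatEquivNat (Sum.inl n)))
      continuous_of_discreteTopology)
    (stoneCechExtend (g := fun n => stoneCechUnit (Equiv.natSumNatEquivNat (Sum.inr n)))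
      continuous_of_discreteTopology)
  left_inv := congrFun <| stoneCech_hom_ext
    (((continuous_stoneCechExtend _).sumElim (continuous_stoneCechExtend _)).comp
      (continuous_stoneCechExtend _)) continuous_id <| by
    ext n
    obtain ⟨n | n, rfl⟩ := Equiv.natSumNatEquivNat.surjective n <;>
      simp only [Function.comp_apply, stoneCechExtend_stoneCechUnit, Equiv.symm_apply_apply,
        Sum.map_inl, Sum.map_inr, Sum.elim_inl, Sum.elim_inr]
  right_inv := by
    rintro (t | t)
    · refine congrFun (stoneCech_hom_ext
        ((continuous_stoneCechExtend _).comp (continuous_stoneCechExtend _)) continuous_inl ?_) t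
      ext n
      simp only [Function.comp_apply, stoneCechExtend_stoneCechUnit, Equiv.symm_apply_apply,
        Sum.map_inl]
    · refine congrFun (stoneCech_hom_ext
        ((continuous_stoneCechExtend _).comp (continuous_stoneCechExtend _)) continuous_inr ?_) t
      ext n
      simp only [Function.comp_apply, stoneCechExtend_stoneCechUnit, Equiv.symm_apply_apply,
        Sum.map_inr]
  continuous_toFun := continuous_stoneCechExtend _
  continuous_invFun := (continuous_stoneCechExtend _).sumElim (continuous_stoneCechExtend _)

/-- If `C(Z)` is isomorphic to its square and embeds in `C(X)` with a left inverse, then adding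
`Z` as a disjoint summand to `X` does not change the isomorphism type of `C(X)`. -/
theorem nonempty_equiv_sum_of_retraction [CompactSpace X] [CompactSpace Z]
    (e : Z ≃ₜ Z ⊕ Z) (R : C(X, 𝕜) →L[𝕜] C(Z, 𝕜)) (E : C(Z, 𝕜) →L[𝕜] C(X, 𝕜))
    (h : Function.RightInverse E R) : Nonempty (C(X, 𝕜) ≃L[𝕜] C(X ⊕ Z, 𝕜)) := by
  let s : C(X, 𝕜) ≃L[𝕜] C(Z, 𝕜) × R.ker := ContinuousLinearEquiv.equivOfRightInverse R E h
  let d : C(Z, 𝕜) ≃L[𝕜] C(Z, 𝕜) × C(Z, 𝕜) :=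
    (ContinuousLinearEquiv.equivOfInverse (ContinuousMap.compCLM 𝕜 𝕜 (e.symm : C(Z ⊕ Z, Z)))
      (ContinuousMap.compCLM 𝕜 𝕜 (e : C(Z, Z ⊕ Z))) (fun f => by ext; simp)
      (fun f => by ext; simp)).trans continuousMapSumEquiv
  -- With `W = R.ker`: `C(X) ≅ C(Z) × W ≅ (C(Z) × C(Z)) × W ≅ (C(Z) × W) × C(Z) ≅ C(X) × C(Z)`.
  exact ⟨s.trans <| (d.prodCongr (.refl 𝕜 _)).trans <|
    (ContinuousLinearEquiv.prodAssoc 𝕜 _ _ _).trans <|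
    (ContinuousLinearEquiv.prodComm 𝕜 _ _).trans <|
    (s.symm.prodCongr (.refl 𝕜 _)).trans continuousMapSumEquiv.symm⟩

end Isomorphism

/-- The canonical map `βℕ → B`, `t ↦ δ_t`. -/
noncomputable def dirac (𝕜 : Type*) [RCLike 𝕜] : C(StoneCech ℕ, DualBall 𝕜) where
  toFun t := ⟨StrongDual.toWeakDual (ContinuousMap.evalCLM 𝕜 t),
    ContinuousLinearMap.opNorm_le_bound _ zero_le_one fun x => by
      rw [one_mul]
      exact x.norm_coe_le_norm t⟩
  continuous_toFun := Continuous.subtype_mk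
    (WeakDual.continuous_of_continuous_eval fun x => x.continuous) _

/-- The canonical map `C(βℕ) → C(B)`, `x ↦ (φ ↦ φ x)`. -/
noncomputable def evaluation (𝕜 : Type*) [RCLike 𝕜] : C(StoneCech ℕ, 𝕜) →L[𝕜] C(DualBall 𝕜, 𝕜) :=
  LinearMap.mkContinuous
    { toFun x := ⟨fun φ => φ.1 x, (WeakDual.eval_continuous x).comp continuous_subtype_val⟩
      map_add' := fun x y => by ext φ; exact map_add φ.1 x y
      map_smul' := fun c x => by ext φ; exact map_smul φ.1 c x } 1 fun x => by
    refine (ContinuousMap.norm_le _ (by positivity)).mpr fun φ => ?_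
    exact (WeakDual.toStrongDual φ.1).le_of_opNorm_le φ.2 x

theorem nonempty_equiv_dualBall_sum (𝕜 : Type*) [RCLike 𝕜] :
    Nonempty (C(DualBall 𝕜, 𝕜) ≃L[𝕜] C(DualBall 𝕜 ⊕ StoneCech ℕ, 𝕜)) :=
  nonempty_equiv_sum_of_retraction stoneCechNatSumHomeomorph
    -- Restricting `φ ↦ φ x` to the point masses recovers `x`, since `δ_t x = x t`.
    (ContinuousMap.compCLM 𝕜 𝕜 (dirac 𝕜)) (evaluation 𝕜) fun _ => rfl

end BishopProperty

theorem mainTheorem5 (𝕜 : Type) [RCLike 𝕜] :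
    (BishopProperty.SpaceBishop 𝕜 (BishopProperty.DualBall 𝕜) ∧
      Nonempty (C(BishopProperty.DualBall 𝕜, 𝕜) ≃L[𝕜]
        C(BishopProperty.DualBall 𝕜 ⊕ StoneCech ℕ, 𝕜)) ∧
      ¬ BishopProperty.SpaceBishop 𝕜 (BishopProperty.DualBall 𝕜 ⊕ StoneCech ℕ)) ∧
    ¬ ∀ (K L : Type) [TopologicalSpace K] [CompactSpace K] [T2Space K]
        [TopologicalSpace L] [CompactSpace L] [T2Space L],
        Nonempty (C(K, 𝕜) ≃L[𝕜] C(L, 𝕜)) →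
          BishopProperty.SpaceBishop 𝕜 K → BishopProperty.SpaceBishop 𝕜 L :=
  ⟨⟨BishopProperty.spaceBishop_of_locallyConnectedSpace,
    BishopProperty.nonempty_equiv_dualBall_sum 𝕜,
    BishopProperty.not_spaceBishop_sum_stoneCech_nat 𝕜 _⟩,
    fun h => BishopProperty.not_spaceBishop_sum_stoneCech_nat 𝕜 _
      (h _ _ (BishopProperty.nonempty_equiv_dualBall_sum 𝕜)
        BishopProperty.spaceBishop_of_locallyConnectedSpace)⟩
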